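/- Let $n\ge 1$ and $k\ge 2$. Let $\mathcal H_a=(\mathbb C^2)^{\otimes n}$ (address qubits $q_a$, numbered $0,\dots,n-1$), $\mathcal H_d=(\mathbb C^2)^{\otimes k}$ (data qubits $q_d$). **Alice's test.** For $\mu<\nu$ in $\{0,1\}^k$ (compared as binary numbers), $m\in\{0,\dots,n-1\}$, $x\in\{0,1\}^n$ and $b\in\{0,1\}$ let $$U_t=\mathrm{SWAP}(0,m)\,Z(x)\,X_0^{b}\,V(\mu,\nu)\,(H^{\otimes n}\otimes I_d)$$ on $\mathcal H_a\otimes\mathcal H_d$. Here $H$ is the Hadamard gate; $V(\mu,\nu)|a\rangle|\tau\rangle=|a\rangle|\tau\oplus\mu\rangle$ if $a_0=0$ and $|a\rangle|\tau\oplus\nu\rangle$ if $a_0=1$; $X_0$ is Pauli $X$ on address qubit $0$; $Z(x)$ applies Pauli $Z$ to the address qubits $j$ with $x_j=1$; $\mathrm{SWAP}(0,m)$ swaps the address qubits $0$ and $m$. A test with parameters $(\mu,\nu,m,x,b)$ has two rounds. In round $r\in\{1,2\}$ Alice sends Bob $|\psi\rangle=U_t|0\rangle^{\otimes(n+k)}$.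 Bob attaches fresh ancilla qubits $q_g$, with finite-dimensional space $\mathcal G_r$, in a fixed (blank) unit state $\theta_r$, and performs on $\mathcal H_a\otimes\mathcal H_d\otimes\mathcal G_r$ a measurement with finitely many measurement operators $E^{(r)}_j$, $\sum_j E_j^{(r)\dagger}E^{(r)}_j=I$; these represent all of his actions in the round. He returns $q_a,q_d$ to Alice, who applies $U_t^\dagger$ and measures all of them in the computational basis. With outcomes $v$, $w\in\{0,1\}^{n+k}$ of the two rounds, Bob passes iff $v_0=w_0$ and $v_j=w_j=0$ for all $j>0$. (The control register, which is in a basis state, is not acted on and is not checked, is omitted.) **Claim.** Suppose that Bob always passes, that is, he passes with probability $1$ for every choice of $(\mu,\nu,m,x,b)$. Then: 1. There are a unitary $U$ on $\mathcal H_a\otimes\mathcal H_d$ and, for $r=1,2$, operators $M^{(r)}_j$ on $\mathcal G_r$ with $\sum_j M_j^{(r)\dagger}M^{(r)}_j=I$ such that, on states with blank ancilla, every measurement operator $E^{(r)}_j$ has the form $U\otimes M^{(r)}_j$: $$E^{(r)}_j(\varphi\otimes\theta_r)=U\varphi\otimes M^{(r)}_j\theta_r\qquad\text{for all }\varphi\in\mathcal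 H_a\otimes\mathcal H_d\text{ and all }j.$$ 2. Bob cannot read any information from $q_a$ and $q_d$ by a one-round attack with these measurements. Precisely, let $\mathcal R$ be a finite-dimensional system for anything else that Bob holds. For $r=1,2$, a density operator $\rho$ on $\mathcal R\otimes\mathcal H_a\otimes\mathcal H_d$ and an outcome $j$ let $$\Omega^{(r)}_j(\rho)=\mathrm{Tr}_{q_a,q_d}\big[(I_{\mathcal R}\otimes E^{(r)}_j)(\rho\otimes|\theta_r\rangle\langle\theta_r|)(I_{\mathcal R}\otimes E^{(r)}_j)^\dagger\big],$$ the unnormalised state that Bob retains after he has received $q_a,q_d$, obtained outcome $j$ and returned $q_a,q_d$; its trace is the probability of $j$. (a) If $\rho,\sigma$ are density operators with $\mathrm{Tr}_{q_a,q_d}\rho=\mathrm{Tr}_{q_a,q_d}\sigma$, then $\Omega^{(r)}_j(\rho)=\Omega^{(r)}_j(\sigma)$ for all $j$. (b) In particular, if Bob sends $q_a,q_d$ of any state $\rho$ to Alice, who applies $U_D(y):|x\rangle|\tau\rangle\mapsto|x\rangle|\tau\oplus d_{x\oplus y}\rangle$ for a database $D=(d_x)_{x\in\{0,1\}^n}$,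 $d_x\in\{0,1\}^k$, and $y\in\{0,1\}^n$, and sends them back, then $\Omega^{(r)}_j\big(U_D(y)\,\rho\,U_D(y)^\dagger\big)$ does not depend on $D$ and $y$, for every $j$. -/

import Mathlib

open scoped Matrix Kronecker ComplexOrder

noncomputable section

namespace QTest

/-! ### Qubit registers, states and measurements -/

/-- Bit strings of length `n`, which label the computational basis of a register of `n` qubits.
Bits are elements of `ZMod 2`, so that bitwise exclusive or is addition.  Qubits are numbered
`0, …, n - 1`. -/
abbrev Bits (n : ℕ) : Type := Fin n → ZMod 2

/-- Basis labels of the joint register of `n` address qubits and `k` data qubits. -/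
abbrev AD (n k : ℕ) : Type := Bits n × Bits k

/-- The number with binary representation `μ 0 μ 1 … μ (k-1)`, most significant bit first. -/
def binVal {k : ℕ} (μ : Bits k) : ℕ := ∑ i : Fin k, (μ i).val * 2 ^ (k - 1 - i.val)

/-- The operator `|q⟩ ↦ |f q⟩` on the computational basis. -/
def basisMap {ι : Type*} [DecidableEq ι] (f : ι → ι) : Matrix ι ι ℂ :=
  Matrix.of fun p q => if p = f q then 1 else 0

/-- The product vector `φ ⊗ θ`. -/
def tensorVec {ι κ : Type*} (φ : ι → ℂ) (θ : κ → ℂ) : ι × κ → ℂ := fun p => φ p.1 * θ p.2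

/-- The operator `|φ⟩⟨φ|`. -/
def pureState {ι : Type*} (φ : ι → ℂ) : Matrix ι ι ℂ := Matrix.vecMulVec φ (star φ)

/-- `φ` is a unit vector (for the Euclidean norm). -/
def IsUnitVec {ι : Type*} [Fintype ι] (φ : ι → ℂ) : Prop := ∑ i, ‖φ i‖ ^ 2 = 1

/-- Density operators. -/
def IsDensity {ι : Type*} [Fintype ι] (ρ : Matrix ι ι ℂ) : Prop := ρ.PosSemidef ∧ ρ.trace = 1

/-- The operators `E j` are the measurement operators of a quantum measurement
(equivalently the Kraus operators of a trace-preserving super-operator). -/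
def IsMeasurement {J ι : Type*} [Fintype J] [Fintype ι] [DecidableEq ι]
    (E : J → Matrix ι ι ℂ) : Prop := ∑ j, (E j)ᴴ * E j = 1

/-- The super-operator `∑ j, E j ∘ (E j)†`. -/
def superOp {J ι : Type*} [Fintype J] [Fintype ι] (E : J → Matrix ι ι ℂ) (ρ : Matrix ι ι ℂ) :
    Matrix ι ι ℂ := ∑ j, E j * ρ * (E j)ᴴ

/-! ### Alice's test states -/

/-- `H^{⊗ n}`, with `H` the Hadamard gate. -/
def hadamard (n : ℕ) : Matrix (Bits n) (Bits n) ℂ :=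
  Matrix.of fun a b => ∏ i, ((-1 : ℂ) ^ (a i * b i).val / (Real.sqrt 2 : ℂ))

/-- Pauli `X` on qubit `i` for those `i` with `y i = 1`. -/
def pauliX {n : ℕ} (y : Bits n) : Matrix (Bits n) (Bits n) ℂ := basisMap fun a => a + y

/-- Pauli `Z` on qubit `i` for those `i` with `x i = 1`. -/
def pauliZ {n : ℕ} (x : Bits n) : Matrix (Bits n) (Bits n) ℂ :=
  Matrix.diagonal fun a => ∏ i, (-1 : ℂ) ^ (x i * a i).val

/-- The gate that swaps the qubits number `0` and `m`. -/
def swapGate {n : ℕ} [NeZero n] (m : Fin n) : Matrix (Bits n) (Bits n) ℂ :=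
  basisMap fun a => a ∘ Equiv.swap 0 m

/-- `V(μ,ν)`: adds `μ` to the data qubits if the first address qubit is `0`, and `ν` if it
is `1`. -/
def writeGate {n k : ℕ} [NeZero n] (μ ν : Bits k) : Matrix (AD n k) (AD n k) ℂ :=
  basisMap fun p => (p.1, p.2 + if p.1 0 = 0 then μ else ν)

/-- The random choices of Alice in a test: `μ < ν` in `{0,1}^k` (as binary numbers), a qubit
number `m`, a string `x` in `{0,1}^n` and a bit `b`. -/
structure Challenge (n k : ℕ) where
  μ : Bits k
  ν : Bits k
  lt : binVal μ < binVal ν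
  m : Fin n
  x : Bits n
  b : ZMod 2

/-- `U_t(m,x,b) = SWAP(0,m) Z(x) X_0^b V(μ,ν) (H^{⊗ n} ⊗ I)`. -/
def testUnitary {n k : ℕ} [NeZero n] (c : Challenge n k) : Matrix (AD n k) (AD n k) ℂ :=
  (swapGate c.m ⊗ₖ (1 : Matrix (Bits k) (Bits k) ℂ)) *
  (pauliZ c.x ⊗ₖ (1 : Matrix (Bits k) (Bits k) ℂ)) *
  (pauliX (Pi.single 0 c.b) ⊗ₖ (1 : Matrix (Bits k) (Bits k) ℂ)) *
  writeGate c.μ c.ν *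
  (hadamard n ⊗ₖ (1 : Matrix (Bits k) (Bits k) ℂ))

/-- The test state `U_t(m,x,b) |0…0⟩` that Alice sends to Bob. -/
def testState {n k : ℕ} [NeZero n] (c : Challenge n k) : AD n k → ℂ :=
  testUnitary c *ᵥ Pi.single (0 : AD n k) (1 : ℂ)

/-! ### The test -/

section Test

variable {n k : ℕ} [NeZero n] {J G : Type*} [Fintype J] [Fintype G] [DecidableEq G]

/-- The state of address, data and ancilla qubits after one round of the test, in which Alice
sends her test state, Bob attaches ancilla qubits in the state `θ`, performs his measurement on
the address, data and ancilla qubits, returns address and data qubits, and Alice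
applies `U_t†` to them. -/
def roundState (E : J → Matrix (AD n k × G) (AD n k × G) ℂ) (θ : G → ℂ) (c : Challenge n k) :
    Matrix (AD n k × G) (AD n k × G) ℂ :=
  ((testUnitary c)ᴴ ⊗ₖ (1 : Matrix G G ℂ)) *
    superOp E (pureState (tensorVec (testState c) θ)) *
    ((testUnitary c)ᴴ ⊗ₖ (1 : Matrix G G ℂ))ᴴ

/-- The probability that Alice obtains `v` when she measures all address and data qubits at the
end of a round. -/
def outcomeProb (E : J → Matrix (AD n k × G) (AD n k × G) ℂ) (θ : G → ℂ) (c : Challenge n k)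
    (v : AD n k) : ℝ := (∑ g : G, roundState E θ c (v, g) (v, g)).re

end Test

/-- All bits of the outcome except that of address qubit `0` are `0`. -/
def ZeroOffFirst {n k : ℕ} [NeZero n] (v : AD n k) : Prop := (∀ i, i ≠ 0 → v.1 i = 0) ∧ v.2 = 0

/-- The outcomes `v`, `w` of the two rounds of a test for which no dishonesty is detected. -/
def Accepts {n k : ℕ} [NeZero n] (v w : AD n k) : Prop :=
  v.1 0 = w.1 0 ∧ ZeroOffFirst v ∧ ZeroOffFirst w

open Classical in
/-- The probability that Bob passes the test with challenge `c`, if he performs the measurement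
`E₁` with ancilla state `θ₁` in the first round and `E₂` with fresh ancilla qubits in the state
`θ₂` in the second one. -/
def passProb {n k : ℕ} [NeZero n] {J₁ G₁ J₂ G₂ : Type*} [Fintype J₁] [Fintype G₁]
    [DecidableEq G₁] [Fintype J₂] [Fintype G₂] [DecidableEq G₂]
    (E₁ : J₁ → Matrix (AD n k × G₁) (AD n k × G₁) ℂ) (θ₁ : G₁ → ℂ)
    (E₂ : J₂ → Matrix (AD n k × G₂) (AD n k × G₂) ℂ) (θ₂ : G₂ → ℂ) (c : Challenge n k) : ℝ :=
  ∑ v : AD n k, ∑ w : AD n k,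
    if Accepts v w then outcomeProb E₁ θ₁ c v * outcomeProb E₂ θ₂ c w else 0

/-- Bob always passes the test. -/
def AlwaysPasses {n k : ℕ} [NeZero n] {J₁ G₁ J₂ G₂ : Type*} [Fintype J₁] [Fintype G₁]
    [DecidableEq G₁] [Fintype J₂] [Fintype G₂] [DecidableEq G₂]
    (E₁ : J₁ → Matrix (AD n k × G₁) (AD n k × G₁) ℂ) (θ₁ : G₁ → ℂ)
    (E₂ : J₂ → Matrix (AD n k × G₂) (AD n k × G₂) ℂ) (θ₂ : G₂ → ℂ) : Prop :=
  ∀ c : Challenge n k, passProb E₁ θ₁ E₂ θ₂ c = 1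

/-! ### One-round attacks -/

/-- The state of the subsystem `R` of a joint system `R ⊗ S`. -/
def traceRight {R S : Type*} [Fintype S] (ρ : Matrix (R × S) (R × S) ℂ) : Matrix R R ℂ :=
  Matrix.of fun r r' => ∑ s, ρ (r, s) (r', s)

/-- The state `ρ ⊗ |θ⟩⟨θ|` of `R ⊗ S ⊗ G`, where `ρ` is a state of `R ⊗ S`. -/
def attach {R S G : Type*} (ρ : Matrix (R × S) (R × S) ℂ) (θ : G → ℂ) :
    Matrix (R × (S × G)) (R × (S × G)) ℂ :=
  Matrix.of fun p q => ρ (p.1, p.2.1) (q.1, q.2.1) * pureState θ p.2.2 q.2.2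

/-- What Bob keeps when he receives the system `S` of the state `ρ` of `R ⊗ S` (with `R`
anything else that he holds), attaches ancilla qubits `G` in the state `θ`, performs the
measurement `E` on `S ⊗ G` with outcome `j`, and sends `S` away: the unnormalised conditional
state of `R ⊗ G`.  Its trace is the probability of the outcome `j`, and dividing by it gives the
state after the measurement. -/
def retained {R S G J : Type*} [Fintype R] [DecidableEq R] [Fintype S] [Fintype G]
    (E : J → Matrix (S × G) (S × G) ℂ) (θ : G → ℂ) (ρ : Matrix (R × S) (R × S) ℂ) (j : J) :
    Matrix (R × G) (R × G) ℂ :=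
  Matrix.of fun p q => ∑ s,
    (((1 : Matrix R R ℂ) ⊗ₖ E j) * attach ρ θ * ((1 : Matrix R R ℂ) ⊗ₖ E j)ᴴ)
      (p.1, (s, p.2)) (q.1, (s, q.2))

/-- The quantum database `O_D : |x⟩|τ⟩ ↦ |x⟩|τ ⊕ d_x⟩`. -/
def quantumDatabase {n k : ℕ} (D : Bits n → Bits k) : Matrix (AD n k) (AD n k) ℂ :=
  basisMap fun p => (p.1, p.2 + D p.1)

/-- The permuted database `U_D(y) = (X^y ⊗ I) O_D (X^y ⊗ I)`. -/
def permutedDatabase {n k : ℕ} (D : Bits n → Bits k) (y : Bits n) :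
    Matrix (AD n k) (AD n k) ℂ :=
  (pauliX y ⊗ₖ (1 : Matrix (Bits k) (Bits k) ℂ)) * quantumDatabase D *
    (pauliX y ⊗ₖ (1 : Matrix (Bits k) (Bits k) ℂ))

/-- The state after Alice has applied `U_D(y)` to the address and data qubits of the state `ρ`. -/
def queryDatabase {n k : ℕ} {R : Type*} [Fintype R] [DecidableEq R] (D : Bits n → Bits k)
    (y : Bits n) (ρ : Matrix (R × AD n k) (R × AD n k) ℂ) :
    Matrix (R × AD n k) (R × AD n k) ℂ :=
  ((1 : Matrix R R ℂ) ⊗ₖ permutedDatabase D y) * ρ *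
    ((1 : Matrix R R ℂ) ⊗ₖ permutedDatabase D y)ᴴ

/-- On inputs with ancilla state `θ`, every `E j` acts as `U ⊗ M j`. -/
def HasProductForm {S G J : Type*} [Fintype S] [Fintype G]
    (E : J → Matrix (S × G) (S × G) ℂ) (θ : G → ℂ) (U : Matrix S S ℂ) (M : J → Matrix G G ℂ) :
    Prop :=
  ∀ (j : J) (φ : S → ℂ), E j *ᵥ tensorVec φ θ = (U ⊗ₖ M j) *ᵥ tensorVec φ θ

/-- The measurement `E` with ancilla state `θ` reads no information from the address and data
qubits: received states that agree on the other systems that Bob holds lead to the same outcome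
probabilities and the same retained states.  In particular nothing that Bob gets in a
one-round attack (he sends a state, Alice applies `U_D(y)`, he measures and sends
address and data qubits back) depends on the database. -/
def ReadsNothing {n k : ℕ} {G J : Type*} [Fintype G]
    (E : J → Matrix (AD n k × G) (AD n k × G) ℂ) (θ : G → ℂ) : Prop :=
  (∀ (R : Type) [Fintype R] [DecidableEq R] (ρ σ : Matrix (R × AD n k) (R × AD n k) ℂ),
    IsDensity ρ → IsDensity σ → traceRight ρ = traceRight σ →
      ∀ j : J, retained E θ ρ j = retained E θ σ j) ∧
  (∀ (R : Type) [Fintype R] [DecidableEq R] (ρ : Matrix (R × AD n k) (R × AD n k) ℂ),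
    IsDensity ρ → ∀ (D D' : Bits n → Bits k) (y y' : Bits n) (j : J),
      retained E θ (queryDatabase D y ρ) j = retained E θ (queryDatabase D' y' ρ) j)

end QTest

end

open QTest

namespace QTest

/-! ### Bit strings -/

/-! Fixing the ancilla input `θ` and an ancilla output `g` turns `E j` into an operator `ancillaOp E
θ j g` on address and data qubits. Everything rests on showing that all these operators, from both
rounds, are multiples of one unitary `U`.

The two rounds are independent, so passing with certainty forces each round to have one certain
outcome, with the same first bit `t` in both (`exists_outcome_of_accepts`). Hence every such
operator `A` maps the test state `U_t|0…0⟩` to a multiple of `U_t|t0…0⟩`, which has the same data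
word at each address and differs only by signs (`AlwaysPasses.respectsTests`).

Support: for fixed words and `m`, varying `x` gives all characters of the address group, so Fourier
inversion passes from superpositions to single addresses (`RespectsTests.apply_eq_zero`). With a
third data word available, as `k ≥ 2`, this excludes every off-diagonal entry
(`RespectsTests.eq_diagonal`). Phases: the tests with `m = 0`, `x = 0` make diagonal entries agree
up to signs that depend on `t` but not on `A`, and these tests connect all basis labels
(`RespectsTests.signRel`). So `A = A 0 0 • U` with `U` a diagonal matrix of signs; since `t` is
shared, the same `U` serves both rounds.

The scalars, indexed by `j` and `g`, have total squared norm 1 and are therefore the vectors `M j θ`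
of some measurement on the ancilla (`exists_isMeasurement`). The retained state involves `ρ` only
through traces of its blocks, conjugated by `U`; these traces are the reduced state, which no
database query changes. -/

lemma zmodTwo_cases (t : ZMod 2) : t = 0 ∨ t = 1 := by
  revert t; decide

lemma binVal_succ {k : ℕ} (μ : Bits (k + 1)) :
    binVal μ = (μ 0).val * 2 ^ k + binVal (fun i : Fin k => μ i.succ) := by
  unfold binVal
  rw [Fin.sum_univ_succ]
  congr 1
  refine Finset.sum_congr rfl fun i _ => ?_
  congr 2
  simp only [Fin.val_succ]
  omega

lemma binVal_lt {k : ℕ} (μ : Bits k) : binVal μ < 2 ^ k := by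
  induction k with
  | zero => simp [binVal]
  | succ k ih =>
    rw [binVal_succ, pow_succ]
    have h := ih fun i : Fin k => μ i.succ
    have h0 : (μ 0).val ≤ 1 := Nat.le_of_lt_succ (ZMod.val_lt (μ 0))
    nlinarith [Nat.mul_le_mul_right (2 ^ k) h0]

/-- Makes the order on data words total, so that any two distinct words can be used in a challenge,
in one order or the other. -/
lemma binVal_injective {k : ℕ} : Function.Injective (binVal (k := k)) := by
  induction k with
  | zero => intro μ ν _; exact Subsingleton.elim _ _
  | succ k ih =>
    intro μ ν h
    rw [binVal_succ, binVal_succ] at h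
    have hμ := binVal_lt fun i : Fin k => μ i.succ
    have hν := binVal_lt fun i : Fin k => ν i.succ
    have h0 : (μ 0).val = (ν 0).val := by
      have h1 := congrArg (· / 2 ^ k) h
      simpa [Nat.mul_add_div, mul_comm, Nat.div_eq_of_lt hμ, Nat.div_eq_of_lt hν] using h1
    rw [h0] at h
    have ht := ih (Nat.add_left_cancel h)
    funext i
    refine Fin.cases (ZMod.val_injective 2 h0) (fun i => congrFun ht i) i

/-- There are at least three strings of at least two bits. -/
lemma exists_ne_ne {k : ℕ} (hk : 2 ≤ k) (μ ν : Bits k) : ∃ ξ : Bits k, ξ ≠ μ ∧ ξ ≠ ν := by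
  have hcard : ({μ, ν} : Finset (Bits k)).card < (Finset.univ : Finset (Bits k)).card := by
    refine lt_of_le_of_lt (Finset.card_le_two) ?_
    rw [Finset.card_univ, Fintype.card_pi]
    simp only [ZMod.card, Finset.prod_const, Finset.card_univ, Fintype.card_fin]
    calc 2 < 2 ^ 2 := by norm_num
      _ ≤ 2 ^ k := Nat.pow_le_pow_right (by norm_num) hk
  obtain ⟨ξ, -, hξ⟩ := Finset.exists_mem_notMem_of_card_lt_card hcard
  refine ⟨ξ, ?_, ?_⟩ <;> rintro rfl <;> simp at hξ

/-! ### Unitarity of the gates -/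

lemma basisMap_mulVec {ι : Type*} [Fintype ι] [DecidableEq ι] (f : Equiv.Perm ι) (φ : ι → ℂ)
    (p : ι) : (basisMap f *ᵥ φ) p = φ (f.symm p) := by
  simp only [Matrix.mulVec, dotProduct, basisMap, Matrix.of_apply, ite_mul, one_mul, zero_mul]
  rw [Finset.sum_eq_single (f.symm p)]
  · simp
  · intro q _ hq
    rw [if_neg]
    rintro rfl
    simp at hq
  · simp

lemma basisMap_mem_unitaryGroup {ι : Type*} [Fintype ι] [DecidableEq ι] {f : ι → ι}
    (hf : Function.Injective f) : basisMap f ∈ Matrix.unitaryGroup ι ℂ := by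
  rw [Matrix.mem_unitaryGroup_iff']
  ext p q
  simp only [basisMap, Matrix.star_eq_conjTranspose, Matrix.mul_apply, Matrix.conjTranspose_apply,
    Matrix.of_apply, Matrix.one_apply]
  simp [apply_ite, hf.eq_iff, eq_comm]

lemma kronecker_one_mem_unitaryGroup {ι κ : Type*} [Fintype ι] [DecidableEq ι] [Fintype κ]
    [DecidableEq κ] {A : Matrix ι ι ℂ} (hA : A ∈ Matrix.unitaryGroup ι ℂ) :
    A ⊗ₖ (1 : Matrix κ κ ℂ) ∈ Matrix.unitaryGroup (ι × κ) ℂ :=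
  Matrix.kronecker_mem_unitary hA (one_mem _)

lemma kronecker_one_mulVec {ι κ : Type*} [Fintype ι] [Fintype κ] [DecidableEq κ]
    (A : Matrix ι ι ℂ) (φ : ι × κ → ℂ) (i : ι) (l : κ) :
    ((A ⊗ₖ (1 : Matrix κ κ ℂ)) *ᵥ φ) (i, l) = (A *ᵥ fun i' => φ (i', l)) i := by
  simp [Matrix.mulVec, dotProduct, Fintype.sum_prod_type, Matrix.kroneckerMap_apply,
    Matrix.one_apply]

lemma hadamard_mul_self (n : ℕ) : hadamard n * hadamard n = 1 := by
  ext a c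
  have hs : (Real.sqrt 2 : ℂ) * (Real.sqrt 2 : ℂ) = 2 := by
    rw [← Complex.ofReal_mul, Real.mul_self_sqrt (by norm_num)]; norm_num
  have h1 : ∀ s t : ZMod 2, ∑ u : ZMod 2, ((-1 : ℂ) ^ (s * u).val / (Real.sqrt 2 : ℂ)) *
      ((-1 : ℂ) ^ (u * t).val / (Real.sqrt 2 : ℂ)) = if s = t then 1 else 0 := by
    intro s t
    have h2 : ∑ u : ZMod 2, ((-1 : ℂ) ^ (s * u).val / (Real.sqrt 2 : ℂ)) *
      ((-1 : ℂ) ^ (u * t).val / (Real.sqrt 2 : ℂ)) =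
        (1 + (-1 : ℂ) ^ s.val * (-1 : ℂ) ^ t.val) / 2 := by
      -- `ZMod 2` unfolds to `Fin 2`, which lets the two-term sum formula apply.
      have := Fin.sum_univ_two (fun u : Fin 2 => ((-1 : ℂ) ^ (s * (show ZMod 2 from u)).val /
        (Real.sqrt 2 : ℂ)) * ((-1 : ℂ) ^ ((show ZMod 2 from u) * t).val / (Real.sqrt 2 : ℂ)))
      refine this.trans ?_
      change ((-1 : ℂ) ^ (s * 0).val / (Real.sqrt 2 : ℂ)) *
        ((-1 : ℂ) ^ (0 * t).val / (Real.sqrt 2 : ℂ)) + ((-1 : ℂ) ^ (s * 1).val /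
        (Real.sqrt 2 : ℂ)) * ((-1 : ℂ) ^ (1 * t).val / (Real.sqrt 2 : ℂ)) = _
      rw [div_mul_div_comm, div_mul_div_comm, hs, mul_zero, zero_mul, mul_one, one_mul,
        ZMod.val_zero, pow_zero]
      ring
    rw [h2]
    rcases zmodTwo_cases s with rfl | rfl <;> rcases zmodTwo_cases t with rfl | rfl <;>
      norm_num [ZMod.val_one]
  simp only [Matrix.mul_apply, hadamard, Matrix.of_apply, ← Finset.prod_mul_distrib]
  -- The sum over bit strings of a product over qubits factors into one two-term sum per qubit.
  rw [← Fintype.piFinset_univ,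
    ← Finset.prod_univ_sum (fun _ => Finset.univ)
      (fun (i : Fin n) (u : ZMod 2) => ((-1 : ℂ) ^ (a i * u).val / (Real.sqrt 2 : ℂ)) *
        ((-1 : ℂ) ^ (u * c i).val / (Real.sqrt 2 : ℂ)))]
  simp only [h1, Matrix.one_apply, funext_iff, Finset.prod_ite_zero, Finset.prod_const_one,
    Finset.mem_univ, forall_const]

lemma hadamard_conjTranspose (n : ℕ) : (hadamard n)ᴴ = hadamard n := by
  ext a c
  simp [hadamard, Matrix.conjTranspose_apply, mul_comm]

lemma hadamard_mem_unitaryGroup (n : ℕ) : hadamard n ∈ Matrix.unitaryGroup (Bits n) ℂ := by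
  rw [Matrix.mem_unitaryGroup_iff, Matrix.star_eq_conjTranspose, hadamard_conjTranspose,
    hadamard_mul_self]

lemma pauliZ_mem_unitaryGroup {n : ℕ} (x : Bits n) :
    pauliZ x ∈ Matrix.unitaryGroup (Bits n) ℂ := by
  rw [Matrix.mem_unitaryGroup_iff, Matrix.star_eq_conjTranspose, pauliZ,
    Matrix.diagonal_conjTranspose, Matrix.diagonal_mul_diagonal, ← Matrix.diagonal_one]
  congr 1
  funext a
  simp [← Finset.prod_mul_distrib, ← mul_pow]

lemma pauliX_mem_unitaryGroup {n : ℕ} (y : Bits n) :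
    pauliX y ∈ Matrix.unitaryGroup (Bits n) ℂ :=
  basisMap_mem_unitaryGroup (add_left_injective y)

lemma swapGate_mem_unitaryGroup {n : ℕ} [NeZero n] (m : Fin n) :
    swapGate m ∈ Matrix.unitaryGroup (Bits n) ℂ :=
  basisMap_mem_unitaryGroup (Equiv.swap 0 m).surjective.injective_comp_right

lemma injective_controlledAdd {n k : ℕ} (w : Bits n → Bits k) :
    Function.Injective fun p : AD n k => (p.1, p.2 + w p.1) := by
  rintro ⟨a, s⟩ ⟨b, t⟩ h
  simp only [Prod.mk.injEq] at h
  obtain ⟨rfl, h⟩ := h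
  simpa using h

lemma writeGate_mem_unitaryGroup {n k : ℕ} [NeZero n] (μ ν : Bits k) :
    writeGate (n := n) μ ν ∈ Matrix.unitaryGroup (AD n k) ℂ :=
  basisMap_mem_unitaryGroup (injective_controlledAdd fun a => if a 0 = 0 then μ else ν)

lemma testUnitary_mem_unitaryGroup {n k : ℕ} [NeZero n] (c : Challenge n k) :
    testUnitary c ∈ Matrix.unitaryGroup (AD n k) ℂ := by
  unfold testUnitary
  refine mul_mem (mul_mem (mul_mem (mul_mem ?_ ?_) ?_) (writeGate_mem_unitaryGroup _ _)) ?_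
  · exact kronecker_one_mem_unitaryGroup (swapGate_mem_unitaryGroup _)
  · exact kronecker_one_mem_unitaryGroup (pauliZ_mem_unitaryGroup _)
  · exact kronecker_one_mem_unitaryGroup (pauliX_mem_unitaryGroup _)
  · exact kronecker_one_mem_unitaryGroup (hadamard_mem_unitaryGroup _)

lemma permutedDatabase_mem_unitaryGroup {n k : ℕ} (D : Bits n → Bits k) (y : Bits n) :
    permutedDatabase D y ∈ Matrix.unitaryGroup (AD n k) ℂ :=
  mul_mem (mul_mem (kronecker_one_mem_unitaryGroup (pauliX_mem_unitaryGroup _))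
    (basisMap_mem_unitaryGroup (injective_controlledAdd D)))
    (kronecker_one_mem_unitaryGroup (pauliX_mem_unitaryGroup _))

/-! ### The test states -/

/-- The data string that accompanies the address `a` in the test state of the challenge `c`. -/
def testWord {n k : ℕ} (c : Challenge n k) (a : Bits n) : Bits k :=
  if a c.m + c.b = 0 then c.μ else c.ν

lemma pauliX_mulVec {n : ℕ} (y : Bits n) (φ : Bits n → ℂ) (a : Bits n) :
    (pauliX y *ᵥ φ) a = φ (a + y) := by
  have h := basisMap_mulVec (Equiv.addRight y) φ a
  have hy : -y = y := by
    funext i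
    exact ZMod.neg_eq_self_mod_two (y i)
  simpa [hy, pauliX] using h

lemma swapGate_mulVec {n : ℕ} [NeZero n] (m : Fin n) (φ : Bits n → ℂ) (a : Bits n) :
    (swapGate m *ᵥ φ) a = φ (a ∘ Equiv.swap 0 m) := by
  have h := basisMap_mulVec ((Equiv.swap 0 m).arrowCongr (Equiv.refl (ZMod 2))) φ a
  have h2 : ⇑((Equiv.swap 0 m).arrowCongr (Equiv.refl (ZMod 2))) =
      fun a : Bits n => a ∘ Equiv.swap 0 m := by
    funext a i
    simp [Equiv.arrowCongr]
  rw [h2] at h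
  refine h.trans ?_
  congr 1

lemma writeGate_mulVec {n k : ℕ} [NeZero n] (μ ν : Bits k) (φ : AD n k → ℂ) (a : Bits n)
    (s : Bits k) : (writeGate μ ν *ᵥ φ) (a, s) = φ (a, s - if a 0 = 0 then μ else ν) := by
  let f : Equiv.Perm (AD n k) :=
    { toFun := fun p => (p.1, p.2 + if p.1 0 = 0 then μ else ν)
      invFun := fun p => (p.1, p.2 - if p.1 0 = 0 then μ else ν)
      left_inv := fun p => by simp
      right_inv := fun p => by simp }
  exact basisMap_mulVec f φ (a, s)

lemma hadamard_single {n : ℕ} [NeZero n] (t : ZMod 2) (a : Bits n) :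
    hadamard n a (Pi.single 0 t) = (-1 : ℂ) ^ (t * a 0).val / (Real.sqrt 2 : ℂ) ^ n := by
  simp only [hadamard, Matrix.of_apply, Finset.prod_div_distrib, Finset.prod_const,
    Finset.card_univ, Fintype.card_fin]
  congr 1
  rw [Finset.prod_eq_single 0]
  · simp [mul_comm]
  · intro i _ hi
    simp [hi]
  · simp

/-- The bit `t` contributes only the phase `(-1)^(t * (a c.m + c.b))`: the support and the moduli of
the amplitudes are those of the test state. Support arguments can thus ignore `t`, and only phase
comparisons see it. -/
lemma testUnitary_mulVec_single {n k : ℕ} [NeZero n] (c : Challenge n k) (t : ZMod 2)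
    (a : Bits n) (s : Bits k) :
    (testUnitary c *ᵥ Pi.single ((Pi.single 0 t, 0) : AD n k) (1 : ℂ)) (a, s) =
      if s = testWord c a then
        (∏ i, (-1 : ℂ) ^ (c.x i * a (Equiv.swap 0 c.m i)).val) *
          ((-1 : ℂ) ^ (t * (a c.m + c.b)).val / (Real.sqrt 2 : ℂ) ^ n)
      else 0 := by
  unfold testUnitary
  simp only [← Matrix.mulVec_mulVec]
  rw [kronecker_one_mulVec, swapGate_mulVec, kronecker_one_mulVec, pauliZ,
    Matrix.mulVec_diagonal, kronecker_one_mulVec, pauliX_mulVec, writeGate_mulVec,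
    Matrix.mulVec_single_one]
  simp only [Matrix.col_apply, Matrix.kroneckerMap_apply, hadamard_single, Matrix.one_apply,
    Pi.add_apply, Function.comp_apply, Equiv.swap_apply_left, Pi.single_eq_same, sub_eq_zero,
    testWord]
  split_ifs <;> simp

lemma testState_apply {n k : ℕ} [NeZero n] (c : Challenge n k) (a : Bits n) (s : Bits k) :
    testState c (a, s) = if s = testWord c a then
      (∏ i, (-1 : ℂ) ^ (c.x i * a (Equiv.swap 0 c.m i)).val) / (Real.sqrt 2 : ℂ) ^ n else 0 := by
  have h := testUnitary_mulVec_single c 0 a s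
  rw [Pi.single_zero, Prod.mk_zero_zero] at h
  rw [testState, h]
  simp only [zero_mul, ZMod.val_zero, pow_zero, mul_one_div]

/-- The bit `b` exchanges the roles of the two words, so the constraint `μ < ν` costs nothing: if
the words come in the wrong order, take `b = 1`. -/
lemma exists_challenge {n k : ℕ} {μ ν : Bits k} (h : μ ≠ ν) (m : Fin n) (x : Bits n) :
    ∃ c : Challenge n k, c.m = m ∧ c.x = x ∧ ∀ a, testWord c a = if a m = 0 then μ else ν := by
  rcases lt_or_gt_of_ne (binVal_injective.ne h) with hlt | hlt
  · exact ⟨⟨μ, ν, hlt, m, x, 0⟩, rfl, rfl, fun a => by simp [testWord]⟩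
  · refine ⟨⟨ν, μ, hlt, m, x, 1⟩, rfl, rfl, fun a => ?_⟩
    have h2 : (1 : ZMod 2) + 1 = 0 := by decide
    rcases zmodTwo_cases (a m) with h0 | h0 <;> simp [testWord, h0, h2]

/-! ### Operators that respect all test states -/

/-- The operators in `𝒜` map every test state to a multiple of `U_t|v⟩`, where the string
`v ∈ {0…0, 10…0}` depends only on the challenge. -/
def RespectsTests {n k : ℕ} [NeZero n] (𝒜 : Set (Matrix (AD n k) (AD n k) ℂ)) : Prop :=
  ∀ c : Challenge n k, ∃ t : ZMod 2, ∀ A ∈ 𝒜, ∃ l : ℂ, A *ᵥ testState c =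
    l • (testUnitary c *ᵥ Pi.single ((Pi.single 0 t, 0) : AD n k) (1 : ℂ))

/-- The sums are, up to normalisation, the Hadamard transform of `u`, which is its own inverse. -/
lemma eq_zero_of_forall_sum_sign {n : ℕ} {u : Bits n → ℂ}
    (h : ∀ x : Bits n, ∑ a, (∏ i, (-1 : ℂ) ^ (x i * a i).val) * u a = 0) (a : Bits n) :
    u a = 0 := by
  have hu : hadamard n *ᵥ u = 0 := by
    funext x
    simp only [Matrix.mulVec, dotProduct, hadamard, Matrix.of_apply, Finset.prod_div_distrib,
      Pi.zero_apply, div_mul_eq_mul_div, ← Finset.sum_div, h x, zero_div]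
  have h2 : u = 0 := by
    rw [← Matrix.one_mulVec u, ← hadamard_mul_self, ← Matrix.mulVec_mulVec, hu,
      Matrix.mulVec_zero]
  exact congrFun h2 a

lemma sqrt_two_pow_ne_zero (n : ℕ) : (Real.sqrt 2 : ℂ) ^ n ≠ 0 :=
  pow_ne_zero _ (Complex.ofReal_ne_zero.mpr (by positivity))

/-- The diagonal entries of the operators in `𝒜` at `p` and at `q` agree up to a common sign. -/
def SignRel {n k : ℕ} (𝒜 : Set (Matrix (AD n k) (AD n k) ℂ)) (p q : AD n k) : Prop :=
  ∃ e : ℂ, (e = 1 ∨ e = -1) ∧ ∀ A ∈ 𝒜, A p p = e * A q q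

lemma SignRel.symm {n k : ℕ} {𝒜 : Set (Matrix (AD n k) (AD n k) ℂ)} {p q : AD n k}
    (h : SignRel 𝒜 p q) : SignRel 𝒜 q p := by
  obtain ⟨e, he, h⟩ := h
  refine ⟨e, he, fun A hA => ?_⟩
  rw [h A hA, ← mul_assoc]
  rcases he with rfl | rfl <;> norm_num

lemma SignRel.trans {n k : ℕ} {𝒜 : Set (Matrix (AD n k) (AD n k) ℂ)} {p q r : AD n k}
    (h : SignRel 𝒜 p q) (h' : SignRel 𝒜 q r) : SignRel 𝒜 p r := by
  obtain ⟨e, he, h⟩ := h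
  obtain ⟨f, hf, h'⟩ := h'
  refine ⟨e * f, ?_, fun A hA => by rw [h A hA, h' A hA, mul_assoc]⟩
  rcases he with rfl | rfl <;> rcases hf with rfl | rfl <;> norm_num

section Respects

variable {n k : ℕ} [NeZero n] {𝒜 : Set (Matrix (AD n k) (AD n k) ℂ)}

lemma mulVec_testState (A : Matrix (AD n k) (AD n k) ℂ) (c : Challenge n k) (p : AD n k) :
    (A *ᵥ testState c) p = (∑ a, (∏ i, (-1 : ℂ) ^ (c.x i * a (Equiv.swap 0 c.m i)).val) *
      A p (a, testWord c a)) / (Real.sqrt 2 : ℂ) ^ n := by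
  simp only [Matrix.mulVec, dotProduct, Fintype.sum_prod_type, testState_apply, Finset.sum_div]
  refine Finset.sum_congr rfl fun a _ => ?_
  simp only [mul_ite, mul_zero, Finset.sum_ite_eq', Finset.mem_univ, if_true]
  ring

/-- The image of a test state is supported on the graph of `testWord c`, so its amplitude at `(b,
s)` vanishes. As a function of `x` this amplitude is a Fourier transform of the matrix entries in
question. The bit `t` may vary with `x`, but the support does not. -/
lemma RespectsTests.apply_eq_zero (h : RespectsTests 𝒜) {A : Matrix (AD n k) (AD n k) ℂ}
    (hA : A ∈ 𝒜) {μ ν : Bits k} (hμν : μ ≠ ν) (m : Fin n) {b : Bits n} {s : Bits k}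
    (hs : s ≠ if b m = 0 then μ else ν) (a : Bits n) :
    A (b, s) (a, if a m = 0 then μ else ν) = 0 := by
  refine eq_zero_of_forall_sum_sign
    (u := fun a => A (b, s) (a, if a m = 0 then μ else ν)) (fun x => ?_) a
  -- The final swap gate permutes the qubits on which the signs act; permuting `x` beforehand undoes
  -- this.
  obtain ⟨c, rfl, hx, hw⟩ := exists_challenge hμν m (x ∘ Equiv.swap 0 m)
  obtain ⟨t, ht⟩ := h c
  obtain ⟨l, hl⟩ := ht A hA
  have h1 := congrFun hl (b, s)
  rw [mulVec_testState, Pi.smul_apply, testUnitary_mulVec_single, hw b, if_neg hs, smul_zero,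
    div_eq_zero_iff, or_iff_left (sqrt_two_pow_ne_zero n)] at h1
  rw [← h1]
  refine Finset.sum_congr rfl fun a _ => ?_
  rw [hw a, hx]
  congr 1
  exact (Equiv.prod_comp (Equiv.swap 0 c.m) fun i => (-1 : ℂ) ^ (x i * a i).val).symm

lemma RespectsTests.eq_diagonal (h : RespectsTests 𝒜) (hk : 2 ≤ k)
    {A : Matrix (AD n k) (AD n k) ℂ} (hA : A ∈ 𝒜) : A = Matrix.diagonal fun p => A p p := by
  ext ⟨b, s⟩ ⟨a, w⟩
  rw [Matrix.diagonal_apply]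
  split_ifs with he
  · rw [he]
  -- Use a test with words `w` and `ξ`, ordered so that address `a` carries `w`. Address `b` then
  -- carries `w` if it agrees with `a` at qubit `m`, and `ξ` otherwise; the entry vanishes unless
  -- that word is `s`.
  obtain ⟨ξ, hξw, hξs⟩ := exists_ne_ne hk w s
  have key : ∀ m : Fin n, (s ≠ if b m = 0 then (if a m = 0 then w else ξ)
      else (if a m = 0 then ξ else w)) → A (b, s) (a, w) = 0 := by
    intro m hm
    have h1 := h.apply_eq_zero hA (μ := if a m = 0 then w else ξ)
      (ν := if a m = 0 then ξ else w) (by split_ifs; exacts [hξw.symm, hξw]) m hm a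
    by_cases h0 : a m = 0 <;> simpa [h0] using h1
  -- For equal words, take `m` where the addresses differ, so that `b` carries `ξ`. For different
  -- words every `m` works, since neither `w` nor `ξ` equals `s`.
  by_cases hsw : s = w
  · subst hsw
    have hab : ∃ m, b m ≠ a m := by
      by_contra! hall
      exact he (by rw [funext hall])
    obtain ⟨m, hm⟩ := hab
    refine key m ?_
    rcases zmodTwo_cases (a m) with h0 | h0 <;> rcases zmodTwo_cases (b m) with h1 | h1 <;>
      simp_all [Ne.symm]
  · refine key 0 ?_
    split_ifs <;> first | exact hsw | exact hξs.symm

/-- Both labels lie in the support of a single test state with constant amplitude. A diagonal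
operator that maps it to `l` times a signed copy has diagonal entries `± l` there, and the signs are
fixed by the challenge and its `t`. -/
lemma RespectsTests.signRel_of_ne (h : RespectsTests 𝒜) (hk : 2 ≤ k) {μ ν : Bits k}
    (hμν : μ ≠ ν) {a b : Bits n} (ha : a 0 = 0) (hb : b 0 = 1) :
    SignRel 𝒜 (a, μ) (b, ν) := by
  obtain ⟨c, hm, hx, hw⟩ := exists_challenge hμν (0 : Fin n) 0
  obtain ⟨t, ht⟩ := h c
  have entry : ∀ A ∈ 𝒜, ∀ l : ℂ, A *ᵥ testState c =
      l • (testUnitary c *ᵥ Pi.single ((Pi.single 0 t, 0) : AD n k) (1 : ℂ)) →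
      ∀ a : Bits n, A (a, testWord c a) (a, testWord c a) =
        l * (-1 : ℂ) ^ (t * (a c.m + c.b)).val := by
    intro A hA l hl a
    have h1 := congrFun hl (a, testWord c a)
    rw [h.eq_diagonal hk hA, Matrix.mulVec_diagonal, Pi.smul_apply, testUnitary_mulVec_single,
      testState_apply, if_pos rfl, if_pos rfl, hx] at h1
    simp only [Pi.zero_apply, zero_mul, ZMod.val_zero, pow_zero, Finset.prod_const_one, one_mul,
      smul_eq_mul, mul_one_div] at h1
    rw [← mul_div_assoc] at h1
    exact (div_left_inj' (sqrt_two_pow_ne_zero n)).1 h1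
  have hwa : testWord c a = μ := by rw [hw, if_pos ha]
  have hwb : testWord c b = ν := by rw [hw, if_neg (by rw [hb]; decide)]
  refine ⟨(-1 : ℂ) ^ (t * (a c.m + c.b)).val * (-1 : ℂ) ^ (t * (b c.m + c.b)).val, ?_, ?_⟩
  · rw [← pow_add]
    exact neg_one_pow_eq_or ℂ _
  · intro A hA
    obtain ⟨l, hl⟩ := ht A hA
    have h1 := entry A hA l hl a
    have h2 := entry A hA l hl b
    rw [hwa] at h1
    rw [hwb] at h2
    rw [h1, h2]
    have h3 : ((-1 : ℂ) ^ (t * (b c.m + c.b)).val) * (-1 : ℂ) ^ (t * (b c.m + c.b)).val = 1 := by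
      rw [← mul_pow]; norm_num
    linear_combination (-l * (-1 : ℂ) ^ (t * (a c.m + c.b)).val) * h3

lemma RespectsTests.signRel (h : RespectsTests 𝒜) (hk : 2 ≤ k) (p : AD n k) :
    SignRel 𝒜 p 0 := by
  have h0 : ∀ (a : Bits n) (μ : Bits k), a 0 = 0 → SignRel 𝒜 (a, μ) 0 := by
    intro a μ ha
    -- Two labels whose first address bits are both `0` are never related directly, so the chain
    -- passes through a label with first address bit `1` and a word different from both `μ` and `0`.
    obtain ⟨ν, hνμ, hν0⟩ := exists_ne_ne hk μ 0
    exact (h.signRel_of_ne hk hνμ.symm ha (b := fun _ => 1) rfl).trans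
      (h.signRel_of_ne hk hν0.symm (a := 0) rfl rfl).symm
  obtain ⟨a, μ⟩ := p
  rcases zmodTwo_cases (a 0) with ha | ha
  · exact h0 a μ ha
  · obtain ⟨ν, hνμ, -⟩ := exists_ne_ne hk μ μ
    exact (h.signRel_of_ne hk hνμ (a := 0) rfl ha).symm.trans (h0 0 ν rfl)

/-- Operators that respect all tests are multiples of one unitary operator. -/
theorem RespectsTests.exists_unitary (h : RespectsTests 𝒜) (hk : 2 ≤ k) :
    ∃ U ∈ Matrix.unitaryGroup (AD n k) ℂ, ∀ A ∈ 𝒜, A = A 0 0 • U := by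
  choose σ hσ hA using h.signRel hk
  refine ⟨Matrix.diagonal σ, ?_, fun A hA' => ?_⟩
  · rw [Matrix.mem_unitaryGroup_iff, Matrix.star_eq_conjTranspose,
      Matrix.diagonal_conjTranspose, Matrix.diagonal_mul_diagonal, ← Matrix.diagonal_one]
    congr 1
    funext p
    rcases hσ p with hp | hp <;> simp [hp]
  · conv_lhs => rw [h.eq_diagonal hk hA']
    rw [← Matrix.diagonal_smul]
    congr 1
    funext p
    rw [hA p A hA', Pi.smul_apply, smul_eq_mul, mul_comm]

end Respects

/-! ### Measurements with ancilla qubits -/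

section Measurement

variable {S G J : Type*} [Fintype S] [Fintype G]

/-- The operator on the system `S` that results from `E j` with ancilla input `θ` and ancilla
output `g`. -/
def ancillaOp (E : J → Matrix (S × G) (S × G) ℂ) (θ : G → ℂ) (j : J) (g : G) : Matrix S S ℂ :=
  Matrix.of fun q p => ∑ h, E j (q, g) (p, h) * θ h

lemma mulVec_tensorVec (E : J → Matrix (S × G) (S × G) ℂ) (θ : G → ℂ) (j : J) (φ : S → ℂ)
    (q : S) (g : G) : (E j *ᵥ tensorVec φ θ) (q, g) = (ancillaOp E θ j g *ᵥ φ) q := by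
  simp only [Matrix.mulVec, dotProduct, Fintype.sum_prod_type, tensorVec, ancillaOp,
    Matrix.of_apply, Finset.sum_mul]
  refine Finset.sum_congr rfl fun p _ => Finset.sum_congr rfl fun h _ => ?_
  ring

/-- If all `ancillaOp E θ j g` are multiples of one unitary operator, then `E` has product
form. -/
lemma hasProductForm_of_smul {E : J → Matrix (S × G) (S × G) ℂ} {θ : G → ℂ} {U : Matrix S S ℂ}
    {m : J → G → ℂ} (h : ∀ j g, ancillaOp E θ j g = m j g • U) {M : J → Matrix G G ℂ}
    (hM : ∀ j, M j *ᵥ θ = m j) : HasProductForm E θ U M := by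
  intro j φ
  funext ⟨q, g⟩
  rw [mulVec_tensorVec, h, ← hM, Matrix.smul_mulVec, Pi.smul_apply, smul_eq_mul]
  simp only [Matrix.mulVec, dotProduct, Fintype.sum_prod_type, Matrix.kroneckerMap_apply,
    tensorVec]
  rw [Finset.sum_mul_sum, Finset.sum_comm]
  refine Finset.sum_congr rfl fun p _ => Finset.sum_congr rfl fun h _ => ?_
  ring

lemma star_dotProduct_self {ι : Type*} [Fintype ι] (φ : ι → ℂ) :
    star φ ⬝ᵥ φ = ((∑ i, ‖φ i‖ ^ 2 : ℝ) : ℂ) := by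
  simp only [dotProduct, Pi.star_apply, RCLike.star_def, Complex.conj_mul', Complex.ofReal_sum,
    Complex.ofReal_pow]

lemma sum_norm_sq_mulVec {ι κ : Type*} [Fintype ι] [Fintype κ] (A : Matrix κ ι ℂ) (φ : ι → ℂ) :
    ((∑ q, ‖(A *ᵥ φ) q‖ ^ 2 : ℝ) : ℂ) = star φ ⬝ᵥ ((Aᴴ * A) *ᵥ φ) := by
  rw [← star_dotProduct_self, Matrix.star_mulVec, ← Matrix.dotProduct_mulVec,
    Matrix.mulVec_mulVec]

lemma sum_norm_sq_unitary_mulVec {ι : Type*} [Fintype ι] [DecidableEq ι] {A : Matrix ι ι ℂ}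
    (hA : A ∈ Matrix.unitaryGroup ι ℂ) (φ : ι → ℂ) :
    ∑ q, ‖(A *ᵥ φ) q‖ ^ 2 = ∑ q, ‖φ q‖ ^ 2 := by
  have h := sum_norm_sq_mulVec A φ
  rw [← Matrix.star_eq_conjTranspose, (Matrix.mem_unitaryGroup_iff').1 hA, Matrix.one_mulVec,
    star_dotProduct_self] at h
  exact_mod_cast h

variable [DecidableEq S] [DecidableEq G] [Fintype J]

/-- For a unit vector `θ`, attaching the ancilla is isometric, so the operators `ancillaOp E θ j g`
over all `j` and `g` inherit norm preservation from `E`. -/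
lemma IsMeasurement.sum_norm_sq {E : J → Matrix (S × G) (S × G) ℂ} (hE : IsMeasurement E)
    {θ : G → ℂ} (hθ : IsUnitVec θ) (φ : S → ℂ) :
    ∑ j, ∑ g, ∑ q, ‖(ancillaOp E θ j g *ᵥ φ) q‖ ^ 2 = ∑ q, ‖φ q‖ ^ 2 := by
  have h1 : ∑ j, ∑ g, ∑ q, ‖(ancillaOp E θ j g *ᵥ φ) q‖ ^ 2 =
      ∑ j, ∑ p, ‖(E j *ᵥ tensorVec φ θ) p‖ ^ 2 := by
    refine Finset.sum_congr rfl fun j _ => ?_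
    rw [Fintype.sum_prod_type_right]
    simp only [mulVec_tensorVec]
  have h2 : ((∑ j, ∑ p, ‖(E j *ᵥ tensorVec φ θ) p‖ ^ 2 : ℝ) : ℂ) =
      ((∑ p, ‖tensorVec φ θ p‖ ^ 2 : ℝ) : ℂ) := by
    rw [Complex.ofReal_sum]
    simp only [sum_norm_sq_mulVec]
    rw [← dotProduct_sum, ← Matrix.sum_mulVec, hE, Matrix.one_mulVec, star_dotProduct_self]
  rw [h1, Complex.ofReal_injective h2, Fintype.sum_prod_type]
  refine Finset.sum_congr rfl fun q _ => ?_
  simp only [tensorVec, norm_mul, mul_pow, ← Finset.mul_sum]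
  rw [hθ, mul_one]

/-- A unit vector can be completed to a unitary matrix. -/
lemma exists_unitary_col {ι : Type*} [Fintype ι] [DecidableEq ι] {v : ι → ℂ} (hv : IsUnitVec v)
    (i₀ : ι) : ∃ B ∈ Matrix.unitaryGroup ι ℂ, B *ᵥ Pi.single i₀ 1 = v := by
  have hv' : ‖WithLp.toLp 2 v‖ = 1 := by
    rw [EuclideanSpace.norm_eq]
    simp only [IsUnitVec] at hv
    simp [hv]
  have ho : Orthonormal ℂ (({i₀} : Set ι).domRestrict fun _ => WithLp.toLp 2 v) := by
    refine ⟨fun i => hv', fun i j hij => ?_⟩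
    exact absurd (Subsingleton.elim i j) hij
  obtain ⟨b, hb⟩ := ho.exists_orthonormalBasis_extension_of_card_eq (by simp)
  refine ⟨(EuclideanSpace.basisFun ι ℂ).toBasis.toMatrix b,
    (EuclideanSpace.basisFun ι ℂ).toMatrix_orthonormalBasis_mem_unitary b, ?_⟩
  rw [Matrix.mulVec_single_one]
  funext i
  simp [Module.Basis.toMatrix_apply, hb i₀ rfl]

/-- Vectors `m j` whose squared norms add up to `1` are the images of a unit vector under the
operators of a measurement. -/
lemma exists_isMeasurement {θ : G → ℂ} (hθ : IsUnitVec θ) {m : J → G → ℂ}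
    (hm : ∑ j, ∑ g, ‖m j g‖ ^ 2 = 1) :
    ∃ M : J → Matrix G G ℂ, IsMeasurement M ∧ ∀ j, M j *ᵥ θ = m j := by
  classical
  obtain ⟨j₀⟩ : Nonempty J := by
    by_contra hJ
    rw [not_nonempty_iff] at hJ
    simp at hm
  obtain ⟨g₀⟩ : Nonempty G := by
    by_contra hG
    rw [not_nonempty_iff] at hG
    simp at hm
  -- Stinespring dilation: a unitary on `J ⊗ G` sends `|j₀⟩ ⊗ θ` to the vector with components `m j
  -- g`. The blocks of its column `j₀` are the operators `M j`, and orthonormality of these columns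
  -- is the measurement condition.
  let θ' : J × G → ℂ := fun p => if p.1 = j₀ then θ p.2 else 0
  have hθ' : IsUnitVec θ' := by
    have hθ2 := hθ
    simp only [IsUnitVec] at hθ2 ⊢
    rw [Fintype.sum_prod_type, Finset.sum_eq_single j₀]
    · simpa [θ'] using hθ2
    · intro j _ hj
      simp [θ', hj]
    · simp
  obtain ⟨A, hA, hAθ⟩ := exists_unitary_col hθ' (j₀, g₀)
  obtain ⟨B, hB, hBm⟩ := exists_unitary_col (v := fun p : J × G => m p.1 p.2)
    (by simpa only [IsUnitVec, Fintype.sum_prod_type] using hm) (j₀, g₀)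
  have hW : B * star A ∈ Matrix.unitaryGroup (J × G) ℂ := mul_mem hB (Unitary.star_mem hA)
  have hWθ : (B * star A) *ᵥ θ' = fun p => m p.1 p.2 := by
    rw [← hAθ, Matrix.mulVec_mulVec, mul_assoc, (Matrix.mem_unitaryGroup_iff').1 hA, mul_one, hBm]
  refine ⟨fun j => Matrix.of fun g h => (B * star A) (j, g) (j₀, h), ?_, fun j => ?_⟩
  · ext h h'
    have h1 := congrFun (congrFun ((Matrix.mem_unitaryGroup_iff').1 hW) (j₀, h)) (j₀, h')
    rw [Matrix.mul_apply, Fintype.sum_prod_type] at h1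
    simp only [Matrix.sum_apply, Matrix.mul_apply, Matrix.conjTranspose_apply, Matrix.of_apply]
    rw [Matrix.one_apply]
    rw [Matrix.one_apply] at h1
    simpa [Matrix.mul_apply] using h1
  · funext g
    have h1 := congrFun hWθ (j, g)
    rw [← h1]
    simp [Matrix.mulVec, dotProduct, Fintype.sum_prod_type, θ']

end Measurement

/-! ### Passing the test -/

lemma mul_pureState_mul {ι κ : Type*} [Fintype ι] (A : Matrix κ ι ℂ) (φ : ι → ℂ) :
    A * pureState φ * Aᴴ = pureState (A *ᵥ φ) := by
  rw [pureState, pureState, Matrix.mul_vecMulVec, Matrix.vecMulVec_mul, Matrix.star_mulVec]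

section Test

variable {n k : ℕ} [NeZero n] {J G : Type*} [Fintype J] [Fintype G] [DecidableEq G]

/-- Tracing out the ancilla in its computational basis splits the round into the branches `(j, g)`.
Each branch is a pure state, so its contribution is a squared amplitude. -/
lemma outcomeProb_eq (E : J → Matrix (AD n k × G) (AD n k × G) ℂ) (θ : G → ℂ)
    (c : Challenge n k) (v : AD n k) : outcomeProb E θ c v =
      ∑ j, ∑ g, ‖((testUnitary c)ᴴ *ᵥ (ancillaOp E θ j g *ᵥ testState c)) v‖ ^ 2 := by
  have h1 : roundState E θ c = ∑ j, pureState
      (((testUnitary c)ᴴ ⊗ₖ (1 : Matrix G G ℂ)) *ᵥ (E j *ᵥ tensorVec (testState c) θ)) := by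
    simp only [roundState, superOp, Matrix.mul_sum, Matrix.sum_mul, mul_pureState_mul]
  have h2 : ∀ j g, (((testUnitary c)ᴴ ⊗ₖ (1 : Matrix G G ℂ)) *ᵥ
      (E j *ᵥ tensorVec (testState c) θ)) (v, g) =
        ((testUnitary c)ᴴ *ᵥ (ancillaOp E θ j g *ᵥ testState c)) v := by
    intro j g
    rw [kronecker_one_mulVec]
    simp only [mulVec_tensorVec]
  simp only [outcomeProb, h1, Matrix.sum_apply, pureState, Matrix.vecMulVec_apply, Pi.star_apply,
    h2, RCLike.star_def, Complex.mul_conj']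
  rw [Finset.sum_comm, ← Complex.ofReal_re (∑ j, ∑ g, _)]
  push_cast
  rfl

lemma outcomeProb_nonneg (E : J → Matrix (AD n k × G) (AD n k × G) ℂ) (θ : G → ℂ)
    (c : Challenge n k) (v : AD n k) : 0 ≤ outcomeProb E θ c v := by
  rw [outcomeProb_eq]
  positivity

lemma conjTranspose_testUnitary_mem (c : Challenge n k) :
    (testUnitary c)ᴴ ∈ Matrix.unitaryGroup (AD n k) ℂ :=
  Unitary.star_mem (testUnitary_mem_unitaryGroup c)

lemma isUnitVec_testState (c : Challenge n k) : IsUnitVec (testState c) := by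
  rw [IsUnitVec, testState, sum_norm_sq_unitary_mulVec (testUnitary_mem_unitaryGroup c),
    Finset.sum_eq_single 0]
  · simp
  · intro p _ hp
    simp [hp]
  · simp

lemma sum_outcomeProb {E : J → Matrix (AD n k × G) (AD n k × G) ℂ} (hE : IsMeasurement E)
    {θ : G → ℂ} (hθ : IsUnitVec θ) (c : Challenge n k) : ∑ v, outcomeProb E θ c v = 1 := by
  simp only [outcomeProb_eq]
  rw [Finset.sum_comm]
  simp only [Finset.sum_comm (s := (Finset.univ : Finset (AD n k))),
    sum_norm_sq_unitary_mulVec (conjTranspose_testUnitary_mem c)]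
  rw [hE.sum_norm_sq hθ]
  exact isUnitVec_testState c

/-- If a single outcome `v` has nonzero probability, then the measurement maps the test state
to multiples of `U_t|v⟩`. -/
lemma mulVec_testState_of_outcomeProb {E : J → Matrix (AD n k × G) (AD n k × G) ℂ} {θ : G → ℂ}
    {c : Challenge n k} {v : AD n k} (h : ∀ w, w ≠ v → outcomeProb E θ c w = 0) (j : J) (g : G) :
    ∃ l : ℂ, ancillaOp E θ j g *ᵥ testState c =
      l • (testUnitary c *ᵥ Pi.single v (1 : ℂ)) := by
  set φ := (testUnitary c)ᴴ *ᵥ (ancillaOp E θ j g *ᵥ testState c) with hφ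
  have h1 : φ = φ v • Pi.single v (1 : ℂ) := by
    funext w
    by_cases hw : w = v
    · subst hw; simp
    · rw [Pi.smul_apply, Pi.single_eq_of_ne hw, smul_zero]
      have h0 := h w hw
      rw [outcomeProb_eq, Finset.sum_eq_zero_iff_of_nonneg fun _ _ => by positivity] at h0
      have h2 := h0 j (Finset.mem_univ j)
      rw [Finset.sum_eq_zero_iff_of_nonneg fun _ _ => by positivity] at h2
      have h3 := h2 g (Finset.mem_univ g)
      exact norm_eq_zero.1 (sq_eq_zero_iff.1 h3)
  refine ⟨φ v, ?_⟩
  rw [← Matrix.mulVec_smul, ← h1, hφ, Matrix.mulVec_mulVec, ← Matrix.star_eq_conjTranspose,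
    (Matrix.mem_unitaryGroup_iff).1 (testUnitary_mem_unitaryGroup c), Matrix.one_mulVec]

end Test

lemma Accepts.eq {n k : ℕ} [NeZero n] {v w : AD n k} (h : Accepts v w) :
    w = (Pi.single 0 (v.1 0), 0) := by
  obtain ⟨h0, -, h1, h2⟩ := h
  refine Prod.ext (funext fun i => ?_) h2
  by_cases hi : i = 0
  · subst hi
    simp [h0]
  · simp [hi, h1 i hi]

lemma Accepts.symm {n k : ℕ} [NeZero n] {v w : AD n k} (h : Accepts v w) : Accepts w v :=
  ⟨h.1.symm, h.2.2, h.2.1⟩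

open Classical in
/-- If independent outcomes `v`, `w` are accepted with certainty, then they are deterministic. -/
lemma exists_outcome_of_accepts {n k : ℕ} [NeZero n] {p q : AD n k → ℝ} (hp : ∀ v, 0 ≤ p v)
    (hq : ∀ v, 0 ≤ q v) (hp1 : ∑ v, p v = 1) (hq1 : ∑ v, q v = 1)
    (h : ∑ v, ∑ w, (if Accepts v w then p v * q w else 0) = 1) :
    ∃ t : ZMod 2, (∀ v, v ≠ (Pi.single 0 t, 0) → p v = 0) ∧
      ∀ w, w ≠ (Pi.single 0 t, 0) → q w = 0 := by
  have hpq : ∑ v, ∑ w, p v * q w = 1 := by rw [← Finset.sum_mul_sum, hp1, hq1, one_mul]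
  have hrej : ∑ v, ∑ w, (if Accepts v w then 0 else p v * q w) = 0 := by
    have h1 : ∑ v, ∑ w, (if Accepts v w then 0 else p v * q w) =
        ∑ v, ∑ w, p v * q w - ∑ v, ∑ w, (if Accepts v w then p v * q w else 0) := by
      simp only [← Finset.sum_sub_distrib]
      refine Finset.sum_congr rfl fun v _ => Finset.sum_congr rfl fun w _ => ?_
      split_ifs <;> simp
    rw [h1, hpq, h, sub_self]
  have hnn : ∀ v w, 0 ≤ (if Accepts v w then 0 else p v * q w) := by
    intro v w
    split_ifs
    exacts [le_rfl, mul_nonneg (hp v) (hq w)]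
  -- Rejected pairs have total weight zero and nonnegative weights, so any two outcomes of positive
  -- probability are accepted together. Comparing with one fixed outcome of the other round then
  -- determines each outcome.
  have hacc : ∀ v w, p v ≠ 0 → q w ≠ 0 → Accepts v w := by
    intro v w hv hw
    by_contra hvw
    rw [Finset.sum_eq_zero_iff_of_nonneg fun v _ => Finset.sum_nonneg fun w _ => hnn v w] at hrej
    have h1 := hrej v (Finset.mem_univ v)
    rw [Finset.sum_eq_zero_iff_of_nonneg fun w _ => hnn v w] at h1
    have h2 := h1 w (Finset.mem_univ w)
    rw [if_neg hvw] at h2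
    exact mul_ne_zero hv hw h2
  obtain ⟨v, -, hv⟩ := Finset.exists_ne_zero_of_sum_ne_zero (hp1.trans_ne one_ne_zero)
  obtain ⟨w, -, hw⟩ := Finset.exists_ne_zero_of_sum_ne_zero (hq1.trans_ne one_ne_zero)
  refine ⟨v.1 0, fun v' hv' => ?_, fun w' hw' => ?_⟩
  · by_contra h0
    have h1 := (hacc v' w h0 hw).symm.eq
    rw [← (hacc v w hv hw).1] at h1
    exact hv' h1
  · by_contra h0
    exact hw' (hacc v w' hv h0).eq

/-- The operators of both measurements of a Bob who always passes respect all tests. -/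
lemma AlwaysPasses.respectsTests {n k : ℕ} [NeZero n] {J₁ G₁ J₂ G₂ : Type*} [Fintype J₁]
    [Fintype G₁] [DecidableEq G₁] [Fintype J₂] [Fintype G₂] [DecidableEq G₂]
    {E₁ : J₁ → Matrix (AD n k × G₁) (AD n k × G₁) ℂ} {θ₁ : G₁ → ℂ}
    {E₂ : J₂ → Matrix (AD n k × G₂) (AD n k × G₂) ℂ} {θ₂ : G₂ → ℂ}
    (hE₁ : IsMeasurement E₁) (hθ₁ : IsUnitVec θ₁) (hE₂ : IsMeasurement E₂)
    (hθ₂ : IsUnitVec θ₂) (h : AlwaysPasses E₁ θ₁ E₂ θ₂) :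
    RespectsTests ({A | ∃ j g, ancillaOp E₁ θ₁ j g = A} ∪ {A | ∃ j g, ancillaOp E₂ θ₂ j g = A}) := by
  intro c
  obtain ⟨t, h1, h2⟩ := exists_outcome_of_accepts (outcomeProb_nonneg E₁ θ₁ c)
    (outcomeProb_nonneg E₂ θ₂ c) (sum_outcomeProb hE₁ hθ₁ c) (sum_outcomeProb hE₂ hθ₂ c) (h c)
  refine ⟨t, ?_⟩
  rintro A (⟨j, g, rfl⟩ | ⟨j, g, rfl⟩)
  · exact mulVec_testState_of_outcomeProb h1 j g
  · exact mulVec_testState_of_outcomeProb h2 j g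

/-! ### Retained states -/

/-- The block of an operator on `R ⊗ S` that belongs to the labels `r`, `r'` of `R`. -/
def block {R S : Type*} (ρ : Matrix (R × S) (R × S) ℂ) (r r' : R) : Matrix S S ℂ :=
  Matrix.of fun s s' => ρ (r, s) (r', s')

lemma traceRight_apply {R S : Type*} [Fintype S] (ρ : Matrix (R × S) (R × S) ℂ) (r r' : R) :
    traceRight ρ r r' = (block ρ r r').trace := rfl

lemma trace_unitary_conj {S : Type*} [Fintype S] [DecidableEq S] {U : Matrix S S ℂ}
    (hU : U ∈ Matrix.unitaryGroup S ℂ) (B : Matrix S S ℂ) : (U * B * Uᴴ).trace = B.trace := by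
  rw [Matrix.trace_mul_cycle, ← Matrix.star_eq_conjTranspose,
    (Matrix.mem_unitaryGroup_iff').1 hU, one_mul]

lemma block_kronecker_conj {R S : Type*} [Fintype R] [DecidableEq R] [Fintype S]
    (A : Matrix S S ℂ) (ρ : Matrix (R × S) (R × S) ℂ) (r r' : R) :
    block (((1 : Matrix R R ℂ) ⊗ₖ A) * ρ * ((1 : Matrix R R ℂ) ⊗ₖ A)ᴴ) r r' =
      A * block ρ r r' * Aᴴ := by
  ext s s'
  simp [block, Matrix.mul_apply, Fintype.sum_prod_type, Matrix.one_apply, apply_ite]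

lemma traceRight_queryDatabase {n k : ℕ} {R : Type*} [Fintype R] [DecidableEq R]
    (D : Bits n → Bits k) (y : Bits n) (ρ : Matrix (R × AD n k) (R × AD n k) ℂ) :
    traceRight (queryDatabase D y ρ) = traceRight ρ := by
  ext r r'
  rw [traceRight_apply, queryDatabase, block_kronecker_conj,
    trace_unitary_conj (permutedDatabase_mem_unitaryGroup D y), ← traceRight_apply]

/-- Each ancilla component of the state after the measurement comes from one operator `ancillaOp`,
acting only on the `S` part of a block; tracing out `S` leaves the trace of the conjugated block. -/
lemma retained_apply {R S G J : Type*} [Fintype R] [DecidableEq R] [Fintype S] [Fintype G]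
    (E : J → Matrix (S × G) (S × G) ℂ) (θ : G → ℂ) (ρ : Matrix (R × S) (R × S) ℂ) (j : J)
    (p q : R × G) : retained E θ ρ j p q =
      (ancillaOp E θ j p.2 * block ρ p.1 q.1 * (ancillaOp E θ j q.2)ᴴ).trace := by
  rw [retained, Matrix.of_apply, Matrix.trace]
  refine Finset.sum_congr rfl fun s _ => ?_
  have h := congrFun (congrFun (block_kronecker_conj (E j) (attach ρ θ) p.1 q.1) (s, p.2))
    (s, q.2)
  refine h.trans ?_
  simp only [Matrix.mul_apply, Fintype.sum_prod_type, block, attach, Matrix.of_apply, pureState,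
    Matrix.vecMulVec_apply, Pi.star_apply, Matrix.conjTranspose_apply, Matrix.diag_apply,
    ancillaOp, star_sum, star_mul', Finset.sum_mul, Finset.mul_sum]
  refine Finset.sum_congr rfl fun s' _ => ?_
  refine Finset.sum_congr rfl fun h₁ _ => Finset.sum_congr rfl fun s₂ _ =>
    Finset.sum_congr rfl fun h₂ _ => ?_
  ring

/-- If all `ancillaOp E θ j g` are multiples of one unitary operator, then the retained state
is determined by the state of the other systems that Bob holds. -/
lemma retained_eq_of_smul {R S G J : Type*} [Fintype R] [DecidableEq R] [Fintype S]
    [DecidableEq S] [Fintype G] {E : J → Matrix (S × G) (S × G) ℂ} {θ : G → ℂ}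
    {U : Matrix S S ℂ} (hU : U ∈ Matrix.unitaryGroup S ℂ) {m : J → G → ℂ}
    (h : ∀ j g, ancillaOp E θ j g = m j g • U) (ρ : Matrix (R × S) (R × S) ℂ) (j : J) :
    retained E θ ρ j =
      Matrix.of fun p q => m j p.2 * star (m j q.2) * traceRight ρ p.1 q.1 := by
  ext p q
  rw [retained_apply, h, h, Matrix.conjTranspose_smul, Matrix.smul_mul, Matrix.smul_mul,
    Matrix.mul_smul, Matrix.trace_smul, Matrix.trace_smul, trace_unitary_conj hU,
    ← traceRight_apply, Matrix.of_apply, smul_eq_mul, smul_eq_mul, mul_assoc]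

lemma readsNothing_of_smul {n k : ℕ} {G J : Type*} [Fintype G]
    {E : J → Matrix (AD n k × G) (AD n k × G) ℂ} {θ : G → ℂ} {U : Matrix (AD n k) (AD n k) ℂ}
    (hU : U ∈ Matrix.unitaryGroup (AD n k) ℂ) {m : J → G → ℂ}
    (h : ∀ j g, ancillaOp E θ j g = m j g • U) : ReadsNothing E θ := by
  refine ⟨fun R _ _ ρ σ _ _ hρσ j => ?_, fun R _ _ ρ _ D D' y y' j => ?_⟩
  · rw [retained_eq_of_smul hU h, retained_eq_of_smul hU h, hρσ]
  · rw [retained_eq_of_smul hU h, retained_eq_of_smul hU h, traceRight_queryDatabase,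
      traceRight_queryDatabase]

/-- Evaluate norm preservation at one basis vector, on which `U` acts isometrically. This is the
normalisation that `exists_isMeasurement` requires. -/
lemma IsMeasurement.sum_norm_sq_coeff {S G J : Type*} [Fintype S] [DecidableEq S] [Nonempty S]
    [Fintype G] [DecidableEq G] [Fintype J] {E : J → Matrix (S × G) (S × G) ℂ}
    (hE : IsMeasurement E) {θ : G → ℂ} (hθ : IsUnitVec θ) {U : Matrix S S ℂ}
    (hU : U ∈ Matrix.unitaryGroup S ℂ) {m : J → G → ℂ}
    (h : ∀ j g, ancillaOp E θ j g = m j g • U) : ∑ j, ∑ g, ‖m j g‖ ^ 2 = 1 := by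
  obtain ⟨s₀⟩ := ‹Nonempty S›
  have hs : ∑ s, ‖(Pi.single s₀ 1 : S → ℂ) s‖ ^ 2 = 1 := by
    rw [Finset.sum_eq_single s₀]
    · simp
    · intro s _ hs
      simp [hs]
    · simp
  have h1 := hE.sum_norm_sq hθ (Pi.single s₀ 1)
  simpa only [h, Matrix.smul_mulVec, Pi.smul_apply, norm_smul, mul_pow, ← Finset.mul_sum,
    sum_norm_sq_unitary_mulVec hU, hs, mul_one] using h1

end QTest

theorem mainTheorem3 (n k : ℕ) [NeZero n] (hk : 2 ≤ k)
    {J₁ G₁ J₂ G₂ : Type*} [Fintype J₁] [Fintype G₁] [DecidableEq G₁]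
    [Fintype J₂] [Fintype G₂] [DecidableEq G₂]
    (E₁ : J₁ → Matrix (AD n k × G₁) (AD n k × G₁) ℂ) (θ₁ : G₁ → ℂ)
    (E₂ : J₂ → Matrix (AD n k × G₂) (AD n k × G₂) ℂ) (θ₂ : G₂ → ℂ)
    (hE₁ : IsMeasurement E₁) (hθ₁ : IsUnitVec θ₁)
    (hE₂ : IsMeasurement E₂) (hθ₂ : IsUnitVec θ₂)
    (hpass : AlwaysPasses E₁ θ₁ E₂ θ₂) :
    (∃ U ∈ Matrix.unitaryGroup (AD n k) ℂ,
      ∃ (M₁ : J₁ → Matrix G₁ G₁ ℂ) (M₂ : J₂ → Matrix G₂ G₂ ℂ),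
        IsMeasurement M₁ ∧ IsMeasurement M₂ ∧
        HasProductForm E₁ θ₁ U M₁ ∧ HasProductForm E₂ θ₂ U M₂) ∧
    ReadsNothing E₁ θ₁ ∧ ReadsNothing E₂ θ₂ := by
  obtain ⟨U, hU, hA⟩ := (hpass.respectsTests hE₁ hθ₁ hE₂ hθ₂).exists_unitary hk
  have h₁ : ∀ j g, ancillaOp E₁ θ₁ j g = ancillaOp E₁ θ₁ j g 0 0 • U :=
    fun j g => hA _ (Or.inl ⟨j, g, rfl⟩)
  have h₂ : ∀ j g, ancillaOp E₂ θ₂ j g = ancillaOp E₂ θ₂ j g 0 0 • U :=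
    fun j g => hA _ (Or.inr ⟨j, g, rfl⟩)
  obtain ⟨M₁, hM₁, hMθ₁⟩ := exists_isMeasurement hθ₁ (hE₁.sum_norm_sq_coeff hθ₁ hU h₁)
  obtain ⟨M₂, hM₂, hMθ₂⟩ := exists_isMeasurement hθ₂ (hE₂.sum_norm_sq_coeff hθ₂ hU h₂)
  exact ⟨⟨U, hU, M₁, M₂, hM₁, hM₂, hasProductForm_of_smul h₁ hMθ₁,
    hasProductForm_of_smul h₂ hMθ₂⟩, readsNothing_of_smul hU h₁, readsNothing_of_smul hU h₂⟩
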